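/- Let $n \ge 1$, let $\mathcal I_n$ be the set of permutations $\pi$ of $\{1,\dots,n\}$ with $\pi^2 = 1$ (the identity included), let $\mathrm{des}(\pi) = \#\{i \in \{1,\dots,n-1\} : \pi(i) > \pi(i+1)\}$, and let $I_n(t) = \sum_{\pi \in \mathcal I_n} t^{\mathrm{des}(\pi)}$. A nonzero polynomial $p(t) = c_r t^r + \cdots + c_s t^s$ with integer coefficients and $c_r, c_s \ne 0$ is called palindromic of center $m/2$ if $m = r+s$ and $c_{r+i} = c_{s-i}$ for $0 \le i \le m/2 - r$; it is called $\gamma$-positive if it is palindromic of some center $m/2$ and $p(t) = \sum_{k=r}^{\lfloor m/2 \rfloor} \gamma_k t^k (1+t)^{m-2k}$ with integers $\gamma_k \ge 0$. Then $I_n(t)$ is $\gamma$-positive. More explicitly, $I_n(t)$ is palindromic of center $(n-1)/2$, there are unique integers $a_{n,k}$, $0 \le k \le \lfloor (n-1)/2 \rfloor$, with $$I_n(t) = \sum_{k=0}^{\lfloor (n-1)/2 \rfloor} a_{n,k}\, t^k (1+t)^{n-1-2k},$$ and $a_{n,k} \ge 0$ for all of them. -/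

import Mathlib

open Polynomial

/-- The descent set of a permutation `π` of `{0, …, n-1}`: the positions `i` such that `i + 1` is
also a position and `π i > π (i + 1)`. -/
def descentSet {n : ℕ} (π : Equiv.Perm (Fin n)) : Finset (Fin n) :=
  Finset.univ.filter fun i => ∃ h : (i : ℕ) + 1 < n, π ⟨(i : ℕ) + 1, h⟩ < π i

/-- The descent number of a permutation. -/
def des {n : ℕ} (π : Equiv.Perm (Fin n)) : ℕ := (descentSet π).card

/-- The set of involutions in the symmetric group on `n` letters (the identity included). -/
def involutions (n : ℕ) : Finset (Equiv.Perm (Fin n)) :=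
  Finset.univ.filter fun π => π * π = 1

/-- The descent polynomial of the involutions. -/
noncomputable def involutionPoly (n : ℕ) : ℤ[X] :=
  ∑ π ∈ involutions n, (X : ℤ[X]) ^ des π

/-- `p = a_r t^r + ⋯ + a_s t^s`, with `r` the lowest and `s` the highest degree that occurs, is
palindromic of center `m / 2`: `m = r + s` and `a_{r+i} = a_{s-i}` for `0 ≤ i ≤ m / 2 - r`. -/
def IsPalindromic (p : ℤ[X]) (m : ℕ) : Prop :=
  m = p.natTrailingDegree + p.natDegree ∧
    ∀ i : ℕ, 2 * (p.natTrailingDegree + i) ≤ m →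
      p.coeff (p.natTrailingDegree + i) = p.coeff (p.natDegree - i)

/-- `γ_r, …, γ_⌊m/2⌋` are the coefficients of an expansion of `p` in the polynomials
`t^k (1 + t)^(m - 2k)`, `r ≤ k ≤ ⌊m/2⌋`. -/
def IsGammaExpansion (p : ℤ[X]) (r m : ℕ) (γ : ℕ → ℤ) : Prop :=
  p = ∑ k ∈ Finset.Icc r (m / 2), C (γ k) * X ^ k * (1 + X) ^ (m - 2 * k)

/-- `p` is palindromic, of some center `m / 2`, and its expansion in the polynomials
`t^k (1 + t)^(m - 2k)` has nonnegative coefficients. -/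
def IsGammaPositive (p : ℤ[X]) : Prop :=
  ∃ m : ℕ, IsPalindromic p m ∧
    ∃ γ : ℕ → ℤ, IsGammaExpansion p p.natTrailingDegree m γ ∧
      ∀ k ∈ Finset.Icc p.natTrailingDegree (m / 2), 0 ≤ γ k

/-!
Let `I_n` be the descent polynomial of the involutions of `n` letters.

**Counting.** For a permutation `π` of `n` letters, the weakly increasing words `a` of length `n`
over an alphabet of size `s` that increase strictly at every descent of `π` number
`(n + s - 1 - des π).choose n` (`card_compatible`). If `π` is an involution, the pair `(π, a)` is
encoded by the symmetric matrix `A x y = #{i | a i = x, a (π i) = y}` with entry sum `n`. This is a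
bijection onto all symmetric `s × s` matrices over `ℕ` with entry sum `n`: listing the units of `A`
as triples `(x, y, m)`, `m < A x y`, in lexicographic order recovers `a` from the first coordinates
and `π` from the exchange of `x` and `y` (`sum_choose_eq_card_symmMatrices`). Removing one unit from
a cell and from its mirror image shows that the number `c n s` of these matrices satisfies
`n c(n,s) = s c(n-1,s) + (s² + n - 2) c(n-2,s)` (`card_symmMatrices_rec`).

**Recurrence.** Hence `∑ c(n,s) t^s = t I_n(t) / (1-t)^(n+1)`. Multiplication by `s` is `t d/dt` on
the series, and becomes `E_n p = (1 + (n-1) t) p + t (1-t) p'` on the numerators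
(`one_sub_pow_mul_theta`), so that
`n I_n = E_n I_{n-1} + E_n E_{n-1} I_{n-2} + (n-2) (1-t)² I_{n-2}` (`recurrence_of_series`). On the
γ-coefficients, `E_n` acts by `(E_n a)_k = (k+1) a_k + 2 (n-2k) a_{k-1}` and `(1-t)²` by
`a_k - 4 a_{k-1}`. The factor `n!` clears the division by `n`: the recurrence defines integers
`scaledGamma n k`, the γ-coefficients of `n! I_n` (`factorial_mul_involutionPoly`). As the expansion
in the polynomials `t^k (1+t)^(m-2k)` is unitriangular, `n!` divides them.

**Positivity.** Put `j = n - 2k`. All coefficients of the recurrence are nonnegative, except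
possibly that of `a_{n-2,k-1}` when `j` is `1` or `2`. The key is the inequality
`k (k - j) a_{n,k} ≤ 12 j (j + 1) a_{n,k-1}` for all `k` (`RatioBound`): if nonnegative rows satisfy
it, then so do their images under `E_n` and under `E_n E_{n-1} + (n-2) (1-t)²`, at all positions
`1 ≤ j < k` where it has content (`eulerStep_ratio`, `secondStep_ratio`). Since the factor `k (k - j)` is quadratic in `k` and the negative coefficient
only linear, the inequality makes the term in `a_{n-2,k-2}` outweigh the negative one as soon as
`n ≥ 43` (`secondStep_nonneg`); the rows with `n ≤ 42` are computed.
-/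

/-! ### The recurrence for the γ-coefficients -/

/-- The right shift of a sequence: `prev a k = a (k - 1)`, with value `0` at `k = 0`. -/
def prev (a : ℕ → ℤ) : ℕ → ℤ
  | 0 => 0
  | k + 1 => a k

/-- The operator `a ↦ ((k + 1) a_k + 2 (n - 2k) a_{k-1})_k`. It turns the γ-coefficients of the
Eulerian polynomial of `n - 1` letters into those of the Eulerian polynomial of `n` letters. -/
def eulerStep (n : ℕ) (a : ℕ → ℤ) (k : ℕ) : ℤ :=
  (k + 1) * a k + 2 * (n - 2 * k) * prev a k

/-- The part of the recurrence that acts on the row `n` and contributes to the row `n + 2`: two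
Eulerian steps, plus `n` times the action of `(1 - t)²` on γ-coefficients. -/
def secondStep (n : ℕ) (a : ℕ → ℤ) (k : ℕ) : ℤ :=
  eulerStep (n + 2) (eulerStep (n + 1) a) k + n * (a k - 4 * prev a k)

/-- The γ-coefficients of the descent polynomial of the involutions of `n` letters, multiplied by
`n!` so that the recurrence involves no division. The value at `n = 0` plays no role. -/
def scaledGamma : ℕ → ℕ → ℤ
  | 0, _ => 0
  | 1, k => if k = 0 then 1 else 0
  | 2, k => if k = 0 then 2 else 0
  | n + 3, k =>
    eulerStep (n + 3) (scaledGamma (n + 2)) k +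
      (n + 2) * secondStep (n + 1) (scaledGamma (n + 1)) k

@[simp] lemma prev_zero (a : ℕ → ℤ) : prev a 0 = 0 := rfl

@[simp] lemma prev_succ (a : ℕ → ℤ) (k : ℕ) : prev a (k + 1) = a k := rfl

lemma scaledGamma_add_three (n k : ℕ) :
    scaledGamma (n + 3) k = eulerStep (n + 3) (scaledGamma (n + 2)) k +
      (n + 2) * secondStep (n + 1) (scaledGamma (n + 1)) k := rfl

lemma eulerStep_eq_zero {n k : ℕ} {a : ℕ → ℤ} (ha : ∀ i, n ≤ 2 * i + 1 → a i = 0)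
    (hk : n ≤ 2 * k) : eulerStep n a k = 0 := by
  rcases k with _ | k
  · simp [eulerStep, ha 0 (by omega)]
  · simp only [eulerStep, prev_succ]
    rw [ha (k + 1) (by omega)]
    by_cases h : n ≤ 2 * k + 1
    · rw [ha k h]; ring
    · have : n = 2 * (k + 1) := by omega
      subst this
      push_cast; ring

lemma scaledGamma_eq_zero : ∀ {n k : ℕ}, n ≤ 2 * k → scaledGamma n k = 0
  | 0, _, _ => rfl
  | 1, k, h => by simp only [scaledGamma]; rw [if_neg (by omega)]
  | 2, k, h => by simp only [scaledGamma]; rw [if_neg (by omega)]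
  | n + 3, k, h => by
    obtain ⟨k, rfl⟩ : ∃ l, k = l + 1 := ⟨k - 1, by omega⟩
    rw [scaledGamma_add_three, secondStep,
      eulerStep_eq_zero (fun i hi => scaledGamma_eq_zero (n := n + 2) (by omega)) h,
      eulerStep_eq_zero (fun i hi => eulerStep_eq_zero
        (fun i' hi' => scaledGamma_eq_zero (n := n + 1) (by omega)) (by omega)) h,
      prev_succ, scaledGamma_eq_zero (n := n + 1) (k := k + 1) (by omega),
      scaledGamma_eq_zero (n := n + 1) (k := k) (by omega)]
    ring

lemma scaledGamma_zero_pos : ∀ n : ℕ, 0 < scaledGamma (n + 1) 0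
  | 0 => by simp [scaledGamma]
  | 1 => by simp [scaledGamma]
  | n + 2 => by
    have h1 := scaledGamma_zero_pos n
    have h2 := scaledGamma_zero_pos (n + 1)
    rw [scaledGamma_add_three]
    simp only [secondStep, eulerStep, prev_zero, Nat.cast_zero]
    ring_nf at h1 h2 ⊢
    positivity

/-! ### The ratio inequality and nonnegativity -/

/-- The inequality `k (k - j) a_k ≤ 12 j (j + 1) a_{k-1}`, where `j = n - 2k`, for all `k`. For a
nonnegative `a` that vanishes where `j ≤ 0`, it has content only when `1 ≤ j < k`. The constant
`12` is the least integer for which the proof of `secondStep_ratio_aux` works. -/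
def RatioBound (n : ℕ) (a : ℕ → ℤ) : Prop :=
  ∀ k : ℕ, (k : ℤ) * (k - (n - 2 * k)) * a k ≤ 12 * ((n - 2 * k) * (n - 2 * k + 1)) * prev a k

/-- The ratio inequality for an Eulerian step at the position `(j, k)`, in terms of the entries
`a₀, a₁, a₂` at `k, k - 1, k - 2` of the preceding row, where `j` is shifted by `-1, 1, 3`. -/
lemma eulerStep_ratio_aux {j k a₀ a₁ a₂ : ℤ} (hj : 1 ≤ j) (hk : j < k) (h₁ : 0 ≤ a₁)
    (H₁ : k * (k - j + 1) * a₀ ≤ 12 * ((j - 1) * j) * a₁)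
    (H₂ : (k - 1) * (k - j - 2) * a₁ ≤ 12 * ((j + 1) * (j + 2)) * a₂) :
    k * (k - j) * ((k + 1) * a₀ + 2 * j * a₁) ≤
      12 * (j * (j + 1)) * (k * a₁ + 2 * (j + 2) * a₂) := by
  obtain ⟨i, rfl⟩ : ∃ i, j = i + 1 := ⟨j - 1, by ring⟩
  obtain ⟨d, rfl⟩ : ∃ d, k = i + 2 + d := ⟨k - (i + 2), by ring⟩
  have hi : 0 ≤ i := by linarith
  have hd : 0 ≤ d := by linarith
  -- `H₂` removes `a₂`, then `H₁`, whose factor `k - j + 1` is `d + 2`, removes `a₀`; the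
  -- coefficient of `a₁` that remains is a polynomial in `i`, `d` with positive coefficients.
  have e₁ := mul_le_mul_of_nonneg_left H₁ (show 0 ≤ (d + 1) * (i + d + 3) by positivity)
  have e₂ := mul_le_mul_of_nonneg_left H₂ (show 0 ≤ (d + 2) * (2 * (i + 1)) by positivity)
  have e₃ : 0 ≤ (i + 1) * (84 + 78 * d + 18 * d ^ 2 + 52 * i + 20 * i * d + 12 * i ^ 2) * a₁ := by
    positivity
  refine le_of_mul_le_mul_left ?_ (show 0 < d + 2 by linarith)
  linarith

/-- The ratio inequality for `secondStep` at the position `(j, k)`, in terms of the entries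
`a₀, a₁, a₂, a₃` at `k, k - 1, k - 2, k - 3`, where `j` is shifted by `-2, 0, 2, 4`. -/
lemma secondStep_ratio_aux {j k a₀ a₁ a₂ a₃ : ℤ} (hj : 1 ≤ j) (hk : j < k) (h₁ : 0 ≤ a₁)
    (H₁ : k * (k - j + 2) * a₀ ≤ 12 * ((j - 2) * (j - 1)) * a₁)
    (H₂ : (k - 1) * (k - 1 - j) * a₁ ≤ 12 * (j * (j + 1)) * a₂)
    (H₃ : (k - 2) * (k - j - 4) * a₂ ≤ 12 * ((j + 2) * (j + 3)) * a₃) :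
    k * (k - j) * (((k + 1) ^ 2 + (2 * k + j - 2)) * a₀ + ((4 * j - 10) * k - 2 * j + 6) * a₁
        + 4 * j * (j + 1) * a₂) ≤
      12 * (j * (j + 1)) * ((k ^ 2 + (2 * k + j - 2)) * a₁
        + ((4 * j - 2) * (k - 1) - 2 * j + 2) * a₂ + 4 * (j + 2) * (j + 3) * a₃) := by
  obtain ⟨i, rfl⟩ : ∃ i, j = i + 1 := ⟨j - 1, by ring⟩
  obtain ⟨d, rfl⟩ : ∃ d, k = i + 2 + d := ⟨k - (i + 2), by ring⟩
  have hi : 0 ≤ i := by linarith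
  have hd : 0 ≤ d := by linarith
  -- `H₃` removes `a₃`. This leaves `a₂` with the coefficient `16 + 32 i + 48 i d + 48 i²`, which
  -- would become negative for `i = 0` and large `d` with a constant smaller than `12`. Then `H₂`
  -- removes `a₂` and `H₁`, whose factor `k - j + 2` is `d + 3`, removes `a₀`.
  have e₁ := mul_le_mul_of_nonneg_left H₁
    (show 0 ≤ 12 * (d + 1) * ((i + d + 3) ^ 2 + (3 * i + 2 * d + 3)) by positivity)
  have e₂ := mul_le_mul_of_nonneg_left H₂
    (show 0 ≤ (d + 3) * (16 + 32 * i + 48 * i * d + 48 * i ^ 2) by positivity)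
  have e₃ := mul_le_mul_of_nonneg_left H₃
    (show 0 ≤ (d + 3) * (48 * (i + 1) * (i + 2)) by positivity)
  have e₄ : 0 ≤ (6624 + 8736 * d + 4024 * d ^ 2 + 832 * d ^ 3 + 72 * d ^ 4 + 17136 * i
      + 17880 * i * d + 5904 * i * d ^ 2 + 584 * i * d ^ 3 + 12240 * i ^ 2 + 7776 * i ^ 2 * d
      + 1040 * i ^ 2 * d ^ 2 + 3024 * i ^ 3 + 816 * i ^ 3 * d + 288 * i ^ 4) * a₁ := by
    positivity
  refine le_of_mul_le_mul_left ?_ (show 0 < 12 * (d + 3) by linarith)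
  linarith

/-- For nonnegative `b` that vanish where `j ≤ 0`, only the positions with `1 ≤ j < k` matter, and
there `k ≥ 2`. -/
lemma RatioBound.of_interior {n : ℕ} {b : ℕ → ℤ} (hb : ∀ k, 0 ≤ b k)
    (hz : ∀ k, n ≤ 2 * k → b k = 0)
    (H : ∀ k : ℕ, 1 ≤ (n : ℤ) - 2 * (k + 2 : ℕ) → (n : ℤ) - 2 * (k + 2 : ℕ) < (k + 2 : ℕ) →
      ((k + 2 : ℕ) : ℤ) * ((k + 2 : ℕ) - (n - 2 * (k + 2 : ℕ))) * b (k + 2) ≤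
        12 * ((n - 2 * (k + 2 : ℕ)) * (n - 2 * (k + 2 : ℕ) + 1)) * b (k + 1)) :
    RatioBound n b := by
  intro k
  have hp : 0 ≤ prev b k := by
    rcases k with _ | k
    · simp
    · exact hb k
  have hsq : 0 ≤ ((n : ℤ) - 2 * k) * (n - 2 * k + 1) := by
    rcases le_or_gt 0 ((n : ℤ) - 2 * k) with h | h
    · positivity
    · exact mul_nonneg_of_nonpos_of_nonpos h.le (by omega)
  have hR : 0 ≤ 12 * (((n : ℤ) - 2 * k) * (n - 2 * k + 1)) * prev b k := by positivity
  by_cases h1 : n ≤ 2 * k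
  · rw [hz k h1, mul_zero]; exact hR
  by_cases h2 : (k : ℤ) ≤ n - 2 * k
  · refine le_trans ?_ hR
    exact mul_nonpos_of_nonpos_of_nonneg
      (mul_nonpos_of_nonneg_of_nonpos (by positivity) (by linarith)) (hb k)
  obtain ⟨k, rfl⟩ : ∃ l, k = l + 2 := ⟨k - 2, by omega⟩
  exact H k (by push_cast; omega) (by omega)

lemma eulerStep_ratio {n : ℕ} {a : ℕ → ℤ} (ha : ∀ k, 0 ≤ a k) (h : RatioBound n a) (k : ℕ)
    (h1 : 1 ≤ (n + 1 : ℤ) - 2 * (k + 2 : ℕ)) (h2 : (n + 1 : ℤ) - 2 * (k + 2 : ℕ) < (k + 2 : ℕ)) :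
    ((k + 2 : ℕ) : ℤ) * ((k + 2 : ℕ) - ((n + 1 : ℤ) - 2 * (k + 2 : ℕ))) *
        eulerStep (n + 1) a (k + 2) ≤
      12 * (((n + 1 : ℤ) - 2 * (k + 2 : ℕ)) * ((n + 1 : ℤ) - 2 * (k + 2 : ℕ) + 1)) *
        eulerStep (n + 1) a (k + 1) := by
  have H₁ := h (k + 2)
  have H₂ := h (k + 1)
  obtain ⟨j, hj⟩ : ∃ j : ℤ, j = (n + 1 : ℤ) - 2 * (k + 2 : ℕ) := ⟨_, rfl⟩
  rw [← hj] at h1 h2 ⊢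
  have hn : (n : ℤ) = 2 * (k + 2 : ℕ) + j - 1 := by rw [hj]; ring
  simp only [eulerStep, prev_succ, hn, Nat.cast_add, Nat.cast_one, Nat.cast_ofNat] at H₁ H₂ h2 ⊢
  have := eulerStep_ratio_aux h1 h2 (ha (k + 1)) (a₀ := a (k + 2)) (a₂ := a k)
    (by convert H₁ using 2 <;> ring) (by convert H₂ using 2 <;> ring)
  convert this using 2 <;> ring

lemma secondStep_zero (n : ℕ) (a : ℕ → ℤ) : secondStep n a 0 = (n + 1) * a 0 := by
  simp [secondStep, eulerStep]; ring

/-- The coefficients of `secondStep` at position `k + 1` in terms of `j = (n + 2) - 2 (k + 1)`. The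
middle one is negative for large `k` when `j` is `1` or `2`. -/
lemma secondStep_succ (n : ℕ) (a : ℕ → ℤ) (k : ℕ) (j : ℤ) (hj : (n : ℤ) + 2 = 2 * (k + 1) + j) :
    secondStep n a (k + 1) = ((k + 2) ^ 2 + n) * a (k + 1)
      + ((4 * j - 10) * (k + 1) - 2 * j + 6) * a k + 4 * j * (j + 1) * prev a k := by
  have hn : (n : ℤ) = 2 * (k + 1) + j - 2 := by linarith
  rcases k with _ | k <;>
  · simp only [secondStep, eulerStep, prev_succ, prev_zero]
    push_cast at hn ⊢
    rw [hn]; ring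

lemma secondStep_ratio {n : ℕ} {a : ℕ → ℤ} (ha : ∀ k, 0 ≤ a k) (h : RatioBound n a) (k : ℕ)
    (h1 : 1 ≤ (n + 2 : ℤ) - 2 * (k + 2 : ℕ)) (h2 : (n + 2 : ℤ) - 2 * (k + 2 : ℕ) < (k + 2 : ℕ)) :
    ((k + 2 : ℕ) : ℤ) * ((k + 2 : ℕ) - ((n + 2 : ℤ) - 2 * (k + 2 : ℕ))) *
        secondStep n a (k + 2) ≤
      12 * (((n + 2 : ℤ) - 2 * (k + 2 : ℕ)) * ((n + 2 : ℤ) - 2 * (k + 2 : ℕ) + 1)) *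
        secondStep n a (k + 1) := by
  have H₁ := h (k + 2)
  have H₂ := h (k + 1)
  have H₃ := h k
  obtain ⟨j, hj⟩ : ∃ j : ℤ, j = (n + 2 : ℤ) - 2 * (k + 2 : ℕ) := ⟨_, rfl⟩
  rw [← hj] at h1 h2 ⊢
  have hn : (n : ℤ) = 2 * (k + 2 : ℕ) + j - 2 := by rw [hj]; ring
  rw [secondStep_succ n a (k + 1) j (by rw [hn]; push_cast; ring),
    secondStep_succ n a k (j + 2) (by rw [hn]; push_cast; ring)]
  simp only [prev_succ, hn, Nat.cast_add, Nat.cast_one, Nat.cast_ofNat] at H₁ H₂ H₃ h2 ⊢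
  have := secondStep_ratio_aux h1 h2 (ha (k + 1)) (a₀ := a (k + 2)) (a₂ := a k) (a₃ := prev a k)
    (by convert H₁ using 2 <;> ring) (by convert H₂ using 2 <;> ring)
    (by convert H₃ using 2 <;> ring)
  convert this using 2 <;> ring

/-- The lists of the nonzero entries of the rows `n + 1` and `n + 2` of `scaledGamma`, possibly
padded with zeros; lists make the first rows computable in the kernel. -/
def gammaRows : ℕ → List ℤ × List ℤ
  | 0 => ([1], [2])
  | n + 1 =>
    let r := gammaRows n
    (r.2, (List.range (n / 2 + 2)).map fun k =>
      eulerStep (n + 3) (fun i => r.2.getD i 0) k +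
        (n + 2) * secondStep (n + 1) (fun i => r.1.getD i 0) k)

lemma getD_map_range (f : ℕ → ℤ) (m k : ℕ) (hf : m ≤ k → f k = 0) :
    ((List.range m).map f).getD k 0 = f k := by
  by_cases h : k < m
  · simp [List.getD, h]
  · rw [List.getD_eq_default _ _ (by simpa using h), hf (by omega)]

lemma gammaRows_spec (n : ℕ) :
    (fun k => (gammaRows n).1.getD k 0) = scaledGamma (n + 1) ∧
      (fun k => (gammaRows n).2.getD k 0) = scaledGamma (n + 2) := by
  induction n with
  | zero => constructor <;> funext k <;> rcases k with _ | k <;> simp [gammaRows, scaledGamma]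
  | succ n ih =>
    refine ⟨ih.2, funext fun k => ?_⟩
    simp only [gammaRows]
    rw [ih.1, ih.2, getD_map_range]
    · rfl
    · intro h
      exact scaledGamma_eq_zero (n := n + 3) (by omega)

lemma gammaRows_nonneg : ∀ n < 42, ∀ x ∈ (gammaRows n).1, 0 ≤ x := by
  decide +kernel

lemma scaledGamma_nonneg_of_lt {n : ℕ} (hn : n < 42) (k : ℕ) : 0 ≤ scaledGamma (n + 1) k := by
  rw [← (gammaRows_spec n).1]
  rcases lt_or_ge k (gammaRows n).1.length with h | h
  · simp only [List.getD_eq_getElem _ _ h]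
    exact gammaRows_nonneg n hn _ (List.getElem_mem h)
  · simp only [List.getD_eq_default _ _ h, le_refl]

lemma eulerStep_nonneg {n k : ℕ} {a : ℕ → ℤ} (ha : ∀ k, 0 ≤ a k) (hk : 2 * k ≤ n) :
    0 ≤ eulerStep n a k := by
  have hp : 0 ≤ prev a k := by
    rcases k with _ | k
    · simp
    · exact ha k
  have h1 := ha k
  have : (0 : ℤ) ≤ n - 2 * k := by omega
  unfold eulerStep
  positivity

/-- With `j = n + 2 - 2k`, all coefficients are nonnegative for `j ≥ 3`. For `j = 1` and `j = 2` the
ratio inequality bounds the negative term by the one in `prev a (k - 1)` once `n` is large. -/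
lemma secondStep_nonneg {n k : ℕ} {a : ℕ → ℤ} (ha : ∀ k, 0 ≤ a k) (h : RatioBound n a)
    (hk : 2 * k < n + 2) (hn : 40 < n) : 0 ≤ secondStep n a k := by
  rcases k with _ | k
  · rw [secondStep_zero]
    have := ha 0
    positivity
  obtain ⟨j, hj⟩ : ∃ j : ℕ, n + 2 = 2 * (k + 1) + j := ⟨n - 2 * k, by omega⟩
  rw [secondStep_succ n a k j (by exact_mod_cast hj)]
  have hp : 0 ≤ prev a k := by
    rcases k with _ | k
    · simp
    · exact ha k
  have hj1 : 1 ≤ j := by omega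
  have hH := h k
  have hnj : (n : ℤ) - 2 * k = j := by omega
  rw [hnj] at hH
  have h1 := ha k
  have h2 := ha (k + 1)
  have h3 : 0 ≤ ((k + 2 : ℤ) ^ 2 + n) * a (k + 1) := by positivity
  obtain h | h | h : 3 ≤ j ∨ j = 1 ∨ j = 2 := by omega
  · have : 0 ≤ ((4 * j - 10 : ℤ) * (k + 1) - 2 * j + 6) := by
      obtain ⟨i, rfl⟩ : ∃ i, j = i + 3 := ⟨j - 3, by omega⟩
      push_cast
      ring_nf
      positivity
    positivity
  · subst h
    have hk : 20 ≤ (k : ℤ) := by omega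
    have : 0 ≤ (k * (k - 1) - 3 * (6 * k + 2) : ℤ) * a k := mul_nonneg (by nlinarith) h1
    -- At `j = 1`: `k (k - 1) a_k ≤ 24 a_{k-1}` against `(6k + 2) a_k ≤ 8 a_{k-1}`.
    push_cast at hH ⊢
    linarith
  · subst h
    have hk : 19 ≤ (k : ℤ) := by omega
    have : 0 ≤ (k * (k - 2) - 6 * k : ℤ) * a k := mul_nonneg (by nlinarith) h1
    push_cast at hH ⊢
    linarith

theorem scaledGamma_nonneg_and_ratio (n : ℕ) :
    (∀ k, 0 ≤ scaledGamma n k) ∧ RatioBound n (scaledGamma n) := by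
  induction n using Nat.strong_induction_on with
  | _ n ih =>
  have hnonneg : ∀ k, 0 ≤ scaledGamma n k := by
    intro k
    by_cases hk : n ≤ 2 * k
    · exact (scaledGamma_eq_zero hk).ge
    by_cases hn : n < 43
    · obtain ⟨n, rfl⟩ : ∃ m, n = m + 1 := ⟨n - 1, by omega⟩
      exact scaledGamma_nonneg_of_lt (by omega) k
    obtain ⟨n, rfl⟩ : ∃ m, n = m + 3 := ⟨n - 3, by omega⟩
    rw [scaledGamma_add_three]
    have h1 := eulerStep_nonneg (n := n + 3) (k := k) (ih (n + 2) (by omega)).1 (by omega)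
    have h2 := secondStep_nonneg (k := k) (ih (n + 1) (by omega)).1 (ih (n + 1) (by omega)).2
      (by omega) (by omega)
    positivity
  refine ⟨hnonneg, RatioBound.of_interior hnonneg (fun k => scaledGamma_eq_zero) ?_⟩
  intro k h1 h2
  obtain ⟨n, rfl⟩ : ∃ m, n = m + 3 := ⟨n - 3, by omega⟩
  have e₁ := eulerStep_ratio (ih (n + 2) (by omega)).1 (ih (n + 2) (by omega)).2 k
    (by push_cast at h1 ⊢; linarith) (by push_cast at h2 ⊢; linarith)
  have e₂ := secondStep_ratio (ih (n + 1) (by omega)).1 (ih (n + 1) (by omega)).2 k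
    (by push_cast at h1 ⊢; linarith) (by push_cast at h2 ⊢; linarith)
  have e₃ := mul_le_mul_of_nonneg_left e₂ (show (0 : ℤ) ≤ n + 2 by positivity)
  rw [scaledGamma_add_three, scaledGamma_add_three]
  push_cast at e₁ e₃ ⊢
  linarith

/-! ### The recurrence for polynomials -/

/-- The polynomial `∑ k, a_k t^k (1 + t)^(m - 2k)`, `0 ≤ k ≤ ⌊m/2⌋`, with γ-coefficients `a`. -/
noncomputable def gammaSum (m : ℕ) (a : ℕ → ℤ) : ℤ[X] :=
  ∑ k ∈ Finset.range (m / 2 + 1), C (a k) * X ^ k * (1 + X) ^ (m - 2 * k)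

/-- The operator `p ↦ (1 + (n - 1) t) p + t (1 - t) p'`, which turns the Eulerian polynomial of
`n - 1` letters into that of `n` letters. The parameter is an integer, to allow subtraction. -/
noncomputable def eulerOp (n : ℤ) (p : ℤ[X]) : ℤ[X] :=
  (1 + C (n - 1) * X) * p + X * (1 - X) * derivative p

lemma gammaSum_add (m : ℕ) (a b : ℕ → ℤ) :
    gammaSum m (fun k => a k + b k) = gammaSum m a + gammaSum m b := by
  simp only [gammaSum, ← Finset.sum_add_distrib, C_add]
  exact Finset.sum_congr rfl fun k _ => by ring

lemma gammaSum_const_mul (m : ℕ) (r : ℤ) (a : ℕ → ℤ) :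
    gammaSum m (fun k => r * a k) = C r * gammaSum m a := by
  simp only [gammaSum, Finset.mul_sum, C_mul]
  exact Finset.sum_congr rfl fun k _ => by ring

lemma eulerOp_sum {ι : Type*} (n : ℤ) (s : Finset ι) (p : ι → ℤ[X]) :
    eulerOp n (∑ i ∈ s, p i) = ∑ i ∈ s, eulerOp n (p i) := by
  simp only [eulerOp, derivative_sum, Finset.mul_sum, Finset.sum_add_distrib]

lemma eulerOp_C_mul (n r : ℤ) (p : ℤ[X]) : eulerOp n (C r * p) = C r * eulerOp n p := by
  simp only [eulerOp, derivative_C_mul]; ring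

lemma gammaSum_eq_sum_range {m N : ℕ} {a : ℕ → ℤ} (ha : ∀ k, m < 2 * k → a k = 0)
    (hN : m / 2 + 1 ≤ N) :
    gammaSum m a = ∑ k ∈ Finset.range N, C (a k) * X ^ k * (1 + X) ^ (m - 2 * k) := by
  refine Finset.sum_subset (Finset.range_subset_range.2 hN) fun k _ hk => ?_
  rw [ha k (by simp at hk; omega)]
  simp

lemma sum_range_succ_prev {M : Type*} [AddCommMonoid M] (f : ℕ → ℤ → M) (hf : ∀ k, f k 0 = 0)
    (a : ℕ → ℤ) (N : ℕ) :
    ∑ k ∈ Finset.range (N + 1), f k (prev a k) = ∑ k ∈ Finset.range N, f (k + 1) (a k) := by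
  rw [Finset.sum_range_succ']
  simp [hf]

lemma eulerOp_gammaSum {m : ℕ} {a : ℕ → ℤ} (ha : ∀ k, m < 2 * k → a k = 0) :
    eulerOp (m + 2) (gammaSum m a) = gammaSum (m + 1) (eulerStep (m + 2) a) := by
  rw [gammaSum_eq_sum_range (m := m + 1) (N := m / 2 + 1 + 1)
    (fun k hk => eulerStep_eq_zero (fun i hi => ha i (by omega)) (by omega)) (by omega),
    gammaSum, eulerOp_sum]
  have h1 : ∑ k ∈ Finset.range (m / 2 + 1 + 1),
      C (eulerStep (m + 2) a k) * X ^ k * (1 + X) ^ (m + 1 - 2 * k) =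
      ∑ k ∈ Finset.range (m / 2 + 1 + 1),
        C ((k + 1) * a k) * X ^ k * (1 + X : ℤ[X]) ^ (m + 1 - 2 * k) +
      ∑ k ∈ Finset.range (m / 2 + 1 + 1),
        C (2 * (m + 2 - 2 * k) * prev a k) * X ^ k * (1 + X : ℤ[X]) ^ (m + 1 - 2 * k) := by
    rw [← Finset.sum_add_distrib]
    refine Finset.sum_congr rfl fun k _ => ?_
    simp only [eulerStep, C_add]
    push_cast
    ring
  rw [h1, sum_range_succ_prev (fun k x => C (2 * (m + 2 - 2 * k) * x) * X ^ k *
      (1 + X : ℤ[X]) ^ (m + 1 - 2 * k)) (by simp), Finset.sum_range_succ _ (m / 2 + 1),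
    ha (m / 2 + 1) (by omega)]
  simp only [mul_zero, C_0, zero_mul, add_zero]
  rw [← Finset.sum_add_distrib]
  refine Finset.sum_congr rfl fun k hk => ?_
  obtain ⟨l, rfl⟩ : ∃ l, m = 2 * k + l := ⟨m - 2 * k, by simp at hk; omega⟩
  rw [mul_assoc, eulerOp_C_mul]
  rw [show 2 * k + l - 2 * k = l by omega, show 2 * k + l + 1 - 2 * k = l + 1 by omega,
    show 2 * k + l + 1 - 2 * (k + 1) = l - 1 by omega]
  have hk : (X : ℤ[X]) * derivative (X ^ k : ℤ[X]) = (k : ℤ[X]) * X ^ k := by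
    rcases k with _ | k
    · simp
    · simp; ring
  have hl : derivative ((1 + X : ℤ[X]) ^ l) = (l : ℤ[X]) * (1 + X) ^ (l - 1) := by
    simp [derivative_pow]
  have hl' : (l : ℤ[X]) * (1 + X) ^ l = (l : ℤ[X]) * ((1 + X) ^ (l - 1) * (1 + X)) := by
    rcases l with _ | l
    · simp
    · simp [pow_succ]
  simp only [eulerOp, derivative_mul, hl]
  push_cast
  simp only [map_sub, map_mul, map_add, map_one, map_natCast, map_ofNat]
  linear_combination (C (a k) * (1 - X) * (1 + X) ^ l) * hk + C (a k) * X ^ k * X * hl'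

lemma one_sub_sq_mul_gammaSum {m : ℕ} {a : ℕ → ℤ} (ha : ∀ k, m < 2 * k → a k = 0) :
    (1 - X) ^ 2 * gammaSum m a = gammaSum (m + 2) (fun k => a k - 4 * prev a k) := by
  rw [gammaSum, gammaSum, show (m + 2) / 2 + 1 = m / 2 + 1 + 1 by omega]
  have h1 : ∑ k ∈ Finset.range (m / 2 + 1 + 1),
      C (a k - 4 * prev a k) * X ^ k * (1 + X) ^ (m + 2 - 2 * k) =
      ∑ k ∈ Finset.range (m / 2 + 1 + 1), C (a k) * X ^ k * (1 + X : ℤ[X]) ^ (m + 2 - 2 * k) +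
      ∑ k ∈ Finset.range (m / 2 + 1 + 1),
        C (-4 * prev a k) * X ^ k * (1 + X : ℤ[X]) ^ (m + 2 - 2 * k) := by
    rw [← Finset.sum_add_distrib]
    refine Finset.sum_congr rfl fun k _ => ?_
    simp only [C_sub, C_mul, C_neg]
    ring
  rw [h1, sum_range_succ_prev (fun k x => C (-4 * x) * X ^ k *
      (1 + X : ℤ[X]) ^ (m + 2 - 2 * k)) (by simp), Finset.sum_range_succ _ (m / 2 + 1),
    ha (m / 2 + 1) (by omega)]
  simp only [C_0, zero_mul, add_zero]
  rw [← Finset.sum_add_distrib, Finset.mul_sum]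
  refine Finset.sum_congr rfl fun k hk => ?_
  obtain ⟨l, rfl⟩ : ∃ l, m = 2 * k + l := ⟨m - 2 * k, by simp at hk; omega⟩
  rw [show 2 * k + l - 2 * k = l by omega, show 2 * k + l + 2 - 2 * k = l + 2 by omega,
    show 2 * k + l + 2 - 2 * (k + 1) = l by omega]
  simp only [C_mul, C_neg, map_ofNat]
  ring

/-- The recurrence determines the γ-coefficients of `P n`, up to the factor `n!`. -/
lemma factorial_mul_eq_gammaSum {P : ℕ → ℤ[X]} (h1 : P 1 = 1) (h2 : P 2 = 1 + X)
    (hP : ∀ n : ℕ, C (n + 3 : ℤ) * P (n + 3) = eulerOp (n + 3) (P (n + 2)) +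
      eulerOp (n + 3) (eulerOp (n + 2) (P (n + 1))) + C (n + 1 : ℤ) * ((1 - X) ^ 2 * P (n + 1)))
    (n : ℕ) : C ((n + 1).factorial : ℤ) * P (n + 1) = gammaSum n (scaledGamma (n + 1)) := by
  induction n using Nat.strong_induction_on with
  | _ n ih =>
  rcases n with _ | _ | n
  · simp [gammaSum, h1, scaledGamma]
  · simp [gammaSum, h2, scaledGamma]
  have e₁ := ih n (by omega)
  have e₂ := ih (n + 1) (by omega)
  have z₁ : ∀ k, n < 2 * k → scaledGamma (n + 1) k = 0 :=
    fun k hk => scaledGamma_eq_zero (by omega)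
  have z₂ : ∀ k, n + 1 < 2 * k → scaledGamma (n + 2) k = 0 :=
    fun k hk => scaledGamma_eq_zero (by omega)
  have d₁ := eulerOp_gammaSum z₁
  have d₂ := eulerOp_gammaSum z₂
  have d₃ := one_sub_sq_mul_gammaSum z₁
  have d₄ := eulerOp_gammaSum (m := n + 1) (a := eulerStep (n + 2) (scaledGamma (n + 1)))
    (fun k hk => eulerStep_eq_zero (fun i hi => z₁ i (by omega)) (by omega))
  have hrow : scaledGamma (n + 1 + 1 + 1) = fun k => eulerStep (n + 3) (scaledGamma (n + 2)) k +
      (n + 2) * (eulerStep (n + 3) (eulerStep (n + 2) (scaledGamma (n + 1))) k +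
        (n + 1) * (scaledGamma (n + 1) k - 4 * prev (scaledGamma (n + 1)) k)) := by
    funext k
    rw [scaledGamma_add_three, secondStep]
    push_cast
    rfl
  rw [hrow, gammaSum_add, gammaSum_const_mul, gammaSum_add, gammaSum_const_mul, ← d₃, ← d₄, ← d₁,
    ← d₂, ← e₁, ← e₂]
  simp only [eulerOp_C_mul]
  have := hP n
  push_cast at this ⊢
  rw [show (n : ℤ) + 1 + 2 = n + 3 by ring]
  simp only [Nat.factorial_succ, Nat.cast_mul, C_mul]
  push_cast at this ⊢
  simp only [map_add, map_one, map_natCast, map_ofNat] at this ⊢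
  linear_combination (((n : ℤ[X]) + 2) * (n + 1) * (n.factorial : ℤ[X])) * this

open scoped PowerSeries in
/-- If `G = t P / (1 - t)^m`, then `t G'` is `t (eulerOp m P) / (1 - t)^(m + 1)`. -/
lemma one_sub_pow_mul_theta {m : ℕ} {G : ℤ⟦X⟧} {P : ℤ[X]}
    (h : (1 - PowerSeries.X : ℤ⟦X⟧) ^ m * G = PowerSeries.X * (P : ℤ⟦X⟧)) :
    (1 - PowerSeries.X : ℤ⟦X⟧) ^ (m + 1) * (PowerSeries.X * PowerSeries.derivative ℤ G) =
      PowerSeries.X * (eulerOp m P : ℤ⟦X⟧) := by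
  have hd := congrArg (PowerSeries.derivative ℤ) h
  rw [Derivation.leibniz, Derivation.leibniz, Derivation.leibniz_pow] at hd
  simp only [smul_eq_mul, map_sub, PowerSeries.derivative_X, PowerSeries.derivative_coe,
    nsmul_eq_mul, Derivation.map_one_eq_zero] at hd
  have hm : (m : ℤ⟦X⟧) * (1 - PowerSeries.X : ℤ⟦X⟧) ^ m =
      (m : ℤ⟦X⟧) * ((1 - PowerSeries.X) ^ (m - 1) * (1 - PowerSeries.X)) := by
    rcases m with _ | m
    · simp
    · simp [pow_succ]
  have hcoe : ((eulerOp m P : ℤ[X]) : ℤ⟦X⟧) = (1 + ((m : ℤ⟦X⟧) - 1) * PowerSeries.X) * (P : ℤ⟦X⟧)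
      + PowerSeries.X * (1 - PowerSeries.X) * ((derivative P : ℤ[X]) : ℤ⟦X⟧) := by
    have hcast : (((m : ℤ[X])) : ℤ⟦X⟧) = m := map_natCast coeToPowerSeries.ringHom m
    simp [eulerOp, hcast]
  rw [hcoe]
  linear_combination (PowerSeries.X * (1 - PowerSeries.X : ℤ⟦X⟧)) * hd
    + (PowerSeries.X * (m : ℤ⟦X⟧)) * h
    - PowerSeries.X * G * hm

open scoped PowerSeries in
/-- If `∑ s, c n s t^s = t P n / (1 - t)^(n + 1)`, a recurrence for `c` that is quadratic in `s`
gives a recurrence for the numerators `P n`. -/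
lemma recurrence_of_series {P : ℕ → ℤ[X]} {c : ℕ → ℕ → ℤ}
    (hG : ∀ n : ℕ, (1 - PowerSeries.X : ℤ⟦X⟧) ^ (n + 2) * PowerSeries.mk (c (n + 1)) =
      PowerSeries.X * (P (n + 1) : ℤ⟦X⟧))
    (hc : ∀ n s : ℕ, ((n : ℤ) + 2) * c (n + 2) s = s * c (n + 1) s + ((s : ℤ) ^ 2 + n) * c n s)
    (n : ℕ) : C (n + 3 : ℤ) * P (n + 3) = eulerOp (n + 3) (P (n + 2)) +
      eulerOp (n + 3) (eulerOp (n + 2) (P (n + 1))) +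
      C (n + 1 : ℤ) * ((1 - X) ^ 2 * P (n + 1)) := by
  have t₁ := one_sub_pow_mul_theta (hG (n + 1))
  have t₂ := one_sub_pow_mul_theta (hG n)
  have t₃ := one_sub_pow_mul_theta t₂
  have hs : ((n : ℤ⟦X⟧) + 3) * PowerSeries.mk (c (n + 3)) =
      PowerSeries.X * PowerSeries.derivative ℤ (PowerSeries.mk (c (n + 2))) +
      PowerSeries.X * PowerSeries.derivative ℤ
        (PowerSeries.X * PowerSeries.derivative ℤ (PowerSeries.mk (c (n + 1)))) +
      ((n : ℤ⟦X⟧) + 1) * PowerSeries.mk (c (n + 1)) := by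
    have hθ : ∀ (f : ℤ⟦X⟧) (s : ℕ),
        PowerSeries.coeff s (PowerSeries.X * PowerSeries.derivative ℤ f) =
        s * PowerSeries.coeff s f := by
      intro f s
      rcases s with _ | s
      · simp
      · rw [PowerSeries.coeff_succ_X_mul, PowerSeries.coeff_derivative]
        push_cast; ring
    ext s
    have e₁ : ((n : ℤ⟦X⟧) + 3) = PowerSeries.C (n + 3 : ℤ) := by simp
    have e₂ : ((n : ℤ⟦X⟧) + 1) = PowerSeries.C (n + 1 : ℤ) := by simp
    rw [e₁, e₂, map_add (PowerSeries.coeff s), map_add (PowerSeries.coeff s),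
      PowerSeries.coeff_C_mul, PowerSeries.coeff_C_mul, hθ, hθ, hθ]
    simp only [PowerSeries.coeff_mk]
    have := hc (n + 1) s
    push_cast at this
    linear_combination this
  have hX : (PowerSeries.X : ℤ⟦X⟧) ≠ 0 := PowerSeries.X_ne_zero
  apply Polynomial.coe_injective (R := ℤ)
  apply mul_left_cancel₀ hX
  have g₃ := hG (n + 2)
  have g₁ := hG n
  push_cast at t₁ t₂ t₃ g₁ g₃ ⊢
  rw [show (n : ℤ) + 1 + 2 = n + 3 by ring] at t₁
  rw [show (n : ℤ) + 2 + 1 = n + 3 by ring] at t₃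
  simp only [map_add, map_natCast, map_ofNat, map_one]
  linear_combination (1 - PowerSeries.X : ℤ⟦X⟧) ^ (n + 4) * hs + t₁ + t₃
    + ((n : ℤ⟦X⟧) + 1) * (1 - PowerSeries.X : ℤ⟦X⟧) ^ 2 * g₁ - ((n : ℤ⟦X⟧) + 3) * g₃

/-! ### Symmetric matrices with given sum -/

/-- The symmetric `s × s` matrices over `ℕ` whose entries sum to `n`, as functions on pairs. -/
def symmMatrices (s n : ℕ) : Finset (Fin s × Fin s → ℕ) :=
  (Finset.piAntidiag Finset.univ n).filter fun A => ∀ x y, A (x, y) = A (y, x)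

lemma mem_symmMatrices {s n : ℕ} {A : Fin s × Fin s → ℕ} :
    A ∈ symmMatrices s n ↔ ∑ p, A p = n ∧ ∀ x y, A (x, y) = A (y, x) := by
  simp [symmMatrices]

/-- A unit of a cell `(x, y)`, together with its mirror image if `x ≠ y`, can be removed from the
matrices where that cell is not `0`. -/
lemma sum_entry_symmMatrices {s : ℕ} (n : ℕ) (x y : Fin s) :
    ∑ A ∈ symmMatrices s (n + if x = y then 1 else 2), A (x, y) =
      (symmMatrices s n).card + ∑ A ∈ symmMatrices s n, A (x, y) := by
  set w : Fin s × Fin s → ℕ := fun p => if p = (x, y) ∨ p = (y, x) then 1 else 0 with hw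
  have hwsymm : ∀ u v, w (u, v) = w (v, u) := by
    intro u v
    simp only [hw, Prod.mk.injEq]
    congr 1
    exact propext (by tauto)
  have hwsum : ∑ p, w p = if x = y then 1 else 2 := by
    rw [hw, Finset.sum_boole]
    rcases eq_or_ne x y with rfl | h
    · simp [Finset.filter_eq']
    · rw [if_neg h, Finset.filter_or, Finset.card_union_of_disjoint]
      · simp [Finset.filter_eq']
      · rw [Finset.disjoint_filter]
        rintro p - rfl
        simpa using fun h' _ => h h'
  have himage : ((symmMatrices s n).map (addRightEmbedding w)) ⊆
      symmMatrices s (n + if x = y then 1 else 2) := by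
    intro B hB
    obtain ⟨A, hA, rfl⟩ := Finset.mem_map.1 hB
    rw [mem_symmMatrices] at hA ⊢
    simp only [addRightEmbedding_apply, Pi.add_apply, Finset.sum_add_distrib, hwsum, hA.1, true_and]
    intro u v
    rw [hA.2 u v, hwsymm u v]
  rw [← Finset.sum_subset himage, Finset.sum_map]
  · simp [hw, Finset.sum_add_distrib, add_comm]
  · intro B hB hB'
    by_contra h0
    rw [mem_symmMatrices] at hB
    have hle : w ≤ B := by
      rintro ⟨u, v⟩
      by_cases h : (u, v) = (x, y) ∨ (u, v) = (y, x)
      · have : B (u, v) ≠ 0 := by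
          rcases h with h | h
          · rwa [h]
          · rwa [h, hB.2]
        simp only [hw, if_pos h]
        omega
      · simp [hw, if_neg h]
    have hadd : B - w + w = B := tsub_add_cancel_of_le hle
    refine hB' (Finset.mem_map.2 ⟨B - w, mem_symmMatrices.2 ⟨?_, fun u v => ?_⟩, hadd⟩)
    · have h1 := hB.1
      rw [← hadd] at h1
      simp only [Pi.add_apply, Finset.sum_add_distrib, hwsum] at h1
      exact Nat.add_right_cancel h1
    · simp only [Pi.sub_apply]
      rw [hB.2 u v, hwsymm u v]

/-- The left side counts the units of all matrices of sum `n + 2`. The units of one cell are counted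
by `sum_entry_symmMatrices`, applied once off the diagonal and twice on it to reach the sum `n`. -/
lemma card_symmMatrices_rec (s n : ℕ) :
    (n + 2) * (symmMatrices s (n + 2)).card =
      s * (symmMatrices s (n + 1)).card + (s ^ 2 + n) * (symmMatrices s n).card := by
  have hsum : ∀ m, m * (symmMatrices s m).card =
      ∑ p : Fin s × Fin s, ∑ A ∈ symmMatrices s m, A p := by
    intro m
    rw [Finset.sum_comm, Finset.sum_congr rfl fun A hA => (mem_symmMatrices.1 hA).1]
    simp [mul_comm]
  have key : ∀ p : Fin s × Fin s, ∑ A ∈ symmMatrices s (n + 2), A p =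
      (if p.1 = p.2 then (symmMatrices s (n + 1)).card else 0) + (symmMatrices s n).card +
        ∑ A ∈ symmMatrices s n, A p := by
    rintro ⟨x, y⟩
    by_cases h : x = y
    · have h1 := sum_entry_symmMatrices (n + 1) x y
      have h2 := sum_entry_symmMatrices n x y
      simp only [if_pos h] at h1 h2 ⊢
      rw [h1, h2]; ring
    · have h1 := sum_entry_symmMatrices n x y
      simp only [if_neg h] at h1 ⊢
      rw [h1]; ring
  rw [hsum (n + 2), Finset.sum_congr rfl fun p _ => key p, Finset.sum_add_distrib,
    Finset.sum_add_distrib, ← hsum n]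
  have hdiag : ∑ p : Fin s × Fin s, (if p.1 = p.2 then (symmMatrices s (n + 1)).card else 0) =
      s * (symmMatrices s (n + 1)).card := by
    rw [Fintype.sum_prod_type]
    simp
  rw [hdiag]
  simp
  ring

/-! ### Words compatible with a permutation -/

/-- The word `a` is weakly increasing, and increases strictly at each descent of `π`. -/
def IsCompatible {n s : ℕ} (π : Equiv.Perm (Fin (n + 1))) (a : Fin (n + 1) → Fin s) : Prop :=
  ∀ i : Fin n, a i.castSucc ≤ a i.succ ∧ (π i.succ < π i.castSucc → a i.castSucc < a i.succ)

lemma IsCompatible.monotone {n s : ℕ} {π : Equiv.Perm (Fin (n + 1))} {a : Fin (n + 1) → Fin s}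
    (h : IsCompatible π a) : Monotone a :=
  Fin.monotone_iff_le_succ.2 fun i => (h i).1

/-- A compatible word is constant only on runs without descents, where `π` increases. -/
lemma IsCompatible.lt_of_eq {n s : ℕ} {π : Equiv.Perm (Fin (n + 1))} {a : Fin (n + 1) → Fin s}
    (h : IsCompatible π a) {i j : Fin (n + 1)} (hij : i < j) (ha : a i = a j) : π i < π j := by
  induction j using Fin.induction with
  | zero => exact absurd hij (Fin.not_lt_zero i)
  | succ j ih =>
    have hle : i ≤ j.castSucc := Fin.le_castSucc_iff.2 hij
    have e₁ : a i ≤ a j.castSucc := h.monotone hle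
    have e₂ := (h j).1
    have hstep : π j.castSucc < π j.succ := by
      by_contra hcon
      have hne : π j.succ ≠ π j.castSucc := fun he => by
        have := π.injective he
        simp [Fin.ext_iff] at this
      have := (h j).2 (lt_of_le_of_ne (not_lt.1 hcon) hne)
      exact absurd (e₁.trans_lt this) (by simp [ha])
    rcases hle.eq_or_lt with rfl | hlt
    · exact hstep
    · exact (ih hlt (le_antisymm e₁ (ha ▸ e₂))).trans hstep

lemma des_succ {n : ℕ} (π : Equiv.Perm (Fin (n + 1))) :
    des π = (Finset.univ.filter fun i : Fin n => π i.succ < π i.castSucc).card := by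
  rw [des, ← Finset.card_map Fin.castSuccEmb
    (s := Finset.univ.filter fun i : Fin n => π i.succ < π i.castSucc)]
  refine congrArg Finset.card (Finset.ext fun i => ?_)
  simp only [descentSet, Finset.mem_filter, Finset.mem_univ, true_and, Finset.mem_map,
    Fin.coe_castSuccEmb]
  constructor
  · rintro ⟨h, hi⟩
    exact ⟨⟨i, by omega⟩, hi, rfl⟩
  · rintro ⟨j, hj, rfl⟩
    exact ⟨by simp, hj⟩

/-- The number of steps outside `D` before the position `i`, where `l : Fin n` stands for the step
from `l` to `l + 1`. -/
def ascentsBefore {n : ℕ} (D : Finset (Fin n)) (i : Fin (n + 1)) : ℕ :=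
  (Finset.univ.filter fun l : Fin n => l.castSucc < i ∧ l ∉ D).card

lemma ascentsBefore_zero {n : ℕ} (D : Finset (Fin n)) : ascentsBefore D 0 = 0 := by
  simp [ascentsBefore]

lemma ascentsBefore_last {n : ℕ} (D : Finset (Fin n)) :
    ascentsBefore D (Fin.last n) = n - D.card := by
  simp only [ascentsBefore, Fin.castSucc_lt_last, true_and]
  rw [← Finset.compl_filter]
  simp [Finset.card_compl]

lemma ascentsBefore_succ {n : ℕ} (D : Finset (Fin n)) (i : Fin n) :
    ascentsBefore D i.succ = ascentsBefore D i.castSucc + if i ∈ D then 0 else 1 := by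
  have : (Finset.univ.filter fun l : Fin n => l.castSucc < i.succ ∧ l ∉ D) =
      (Finset.univ.filter fun l : Fin n => l.castSucc < i.castSucc ∧ l ∉ D) ∪
        if i ∈ D then ∅ else {i} := by
    ext l
    rcases eq_or_ne l i with rfl | h
    · by_cases hl : l ∈ D <;> simp [hl]
    · have : (l.castSucc < i.succ) ↔ l.castSucc < i.castSucc := by
        simp only [Fin.lt_def, Fin.val_castSucc, Fin.val_succ]
        have : (l : ℕ) ≠ i := fun h' => h (Fin.ext h')
        omega
      by_cases hi : i ∈ D <;>
      simp only [hi, h, this, Finset.mem_filter, Finset.mem_univ, true_and, if_true, if_false,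
        Finset.union_empty, Finset.mem_union, Finset.mem_singleton, or_false]
  rw [ascentsBefore, this, Finset.card_union_of_disjoint, ascentsBefore]
  · congr 1
    split_ifs <;> simp
  · split_ifs <;> simp

/-- Adding `ascentsBefore D` turns the weakly increasing words that are strict on `D` into the
strictly increasing words over an alphabet of size `s + (n - #D)`, that is, into its subsets of
size `n + 1`. -/
lemma card_compatible {n s : ℕ} (D : Finset (Fin n)) :
    (Finset.univ.filter fun a : Fin (n + 1) → Fin s =>
      ∀ i : Fin n, a i.castSucc ≤ a i.succ ∧ (i ∈ D → a i.castSucc < a i.succ)).card =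
      (s + (n - D.card)).choose (n + 1) := by
  have hstep : ∀ (f : Fin (n + 1) → ℕ), (∀ i : Fin n, f i.castSucc ≤ f i.succ ∧
      (i ∈ D → f i.castSucc < f i.succ)) ↔ StrictMono fun i => f i + ascentsBefore D i := by
    intro f
    rw [Fin.strictMono_iff_lt_succ]
    refine forall_congr' fun i => ?_
    rw [ascentsBefore_succ]
    split_ifs with h <;> simp [h] <;> omega
  rw [← Finset.card_range (s + (n - D.card)), ← Finset.card_powersetCard]
  refine Finset.card_bij (fun a _ => Finset.univ.image fun i => (a i : ℕ) + ascentsBefore D i)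
    ?_ ?_ ?_
  · intro a ha
    simp only [Finset.mem_filter, Finset.mem_univ, true_and] at ha
    have hm := (hstep fun i => (a i : ℕ)).1 ha
    rw [Finset.mem_powersetCard, Finset.card_image_of_injective _ hm.injective]
    refine ⟨fun x hx => ?_, by simp⟩
    obtain ⟨i, -, rfl⟩ := Finset.mem_image.1 hx
    have h1 := hm.monotone (Fin.le_last i)
    have h2 := (a (Fin.last n)).isLt
    rw [Finset.mem_range]
    simp only [ascentsBefore_last] at h1
    omega
  · intro a ha b hb hab
    simp only [Finset.mem_filter, Finset.mem_univ, true_and] at ha hb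
    have hma := (hstep fun i => (a i : ℕ)).1 ha
    have hmb := (hstep fun i => (b i : ℕ)).1 hb
    have := (StrictMono.range_inj hma hmb).1
      (by simpa using congrArg (fun t : Finset ℕ => (t : Set ℕ)) hab)
    funext i
    have := congrFun this i
    exact Fin.ext (by simpa using this)
  · intro t ht
    rw [Finset.mem_powersetCard] at ht
    set b := t.orderEmbOfFin ht.2 with hb
    have hle : ∀ i, ascentsBefore D i ≤ b i := by
      intro i
      induction i using Fin.induction with
      | zero => simp [ascentsBefore_zero]
      | succ i ih =>
        have : b i.castSucc < b i.succ := b.strictMono (by simp)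
        rw [ascentsBefore_succ]
        split_ifs <;> omega
    have hf : (fun i => (b i - ascentsBefore D i) + ascentsBefore D i) = b := by
      funext i
      exact Nat.sub_add_cancel (hle i)
    have hm := (hstep fun i => b i - ascentsBefore D i).2 (by rw [hf]; exact b.strictMono)
    have hlt : ∀ i, b i - ascentsBefore D i < s := by
      intro i
      have h1 : b i - ascentsBefore D i ≤ b (Fin.last n) - ascentsBefore D (Fin.last n) :=
        (Fin.monotone_iff_le_succ (f := fun i => b i - ascentsBefore D i)).2
          (fun i => (hm i).1) (Fin.le_last i)
      have h2 := Finset.mem_range.1 (ht.1 (t.orderEmbOfFin_mem ht.2 (Fin.last n)))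
      have h3 := hle (Fin.last n)
      rw [← hb] at h2
      rw [ascentsBefore_last] at h1 h3
      omega
    refine ⟨fun i => ⟨b i - ascentsBefore D i, hlt i⟩, by simpa using hm, ?_⟩
    simp only [hf]
    ext x
    rw [← Finset.mem_coe, ← Finset.mem_coe, Finset.coe_image, Finset.coe_univ, Set.image_univ, hb,
      Finset.range_orderEmbOfFin]


/-! ### Pairs and symmetric matrices -/

lemma monotone_eq_of_card_fiber_eq {α : Type*} [LinearOrder α] {n : ℕ} {f g : Fin n → α}
    (hf : Monotone f) (hg : Monotone g)
    (h : ∀ c, (Finset.univ.filter fun i => f i = c).card =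
      (Finset.univ.filter fun i => g i = c).card) :
    f = g := by
  have e : ∀ c, {i // g i = c} ≃ {i // f i = c} := fun c =>
    Fintype.equivOfCardEq (by rw [Fintype.card_subtype, Fintype.card_subtype, h c])
  obtain ⟨σ, hσ⟩ : ∃ σ : Equiv.Perm (Fin n), f ∘ σ = g := by
    refine ⟨(Equiv.sigmaFiberEquiv g).symm.trans
      ((Equiv.sigmaCongrRight e).trans (Equiv.sigmaFiberEquiv f)), ?_⟩
    funext i
    exact (e (g i) ⟨i, rfl⟩).2
  have := Tuple.unique_monotone (f := f) (σ := 1) (τ := σ) hf (by rwa [hσ])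
  rw [hσ] at this
  exact this

/-- The matrix of a permutation `π` and a word `a`: its entry at `(x, y)` is the number of positions
`i` with `a i = x` and `a (π i) = y`. -/
def pairMatrix {n s : ℕ} (π : Equiv.Perm (Fin n)) (a : Fin n → Fin s) (p : Fin s × Fin s) : ℕ :=
  (Finset.univ.filter fun i => (a i, a (π i)) = p).card

lemma pairMatrix_mem {n s : ℕ} {π : Equiv.Perm (Fin n)} (hπ : π * π = 1) (a : Fin n → Fin s) :
    pairMatrix π a ∈ symmMatrices s n := by
  rw [mem_symmMatrices]
  constructor
  · simp only [pairMatrix]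
    rw [← Finset.card_eq_sum_card_fiberwise (f := fun i => (a i, a (π i))) (by simp)]
    simp
  · intro x y
    have hinv : ∀ i, π (π i) = i := fun i => by
      have := congrArg (fun σ : Equiv.Perm (Fin n) => σ i) hπ
      simpa using this
    refine Finset.card_bij (fun i _ => π i) ?_ (fun i _ j _ h => π.injective h) ?_
    · intro i hi
      simp only [Finset.mem_filter, Finset.mem_univ, true_and, Prod.mk.injEq, hinv] at hi ⊢
      exact hi.symm
    · intro j hj
      simp only [Finset.mem_filter, Finset.mem_univ, true_and, Prod.mk.injEq] at hj ⊢
      exact ⟨π j, by simp only [hinv]; exact hj.symm, hinv j⟩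

/-- The word of pairs `(a i, a (π i))` is weakly increasing in the lexicographic order, hence
determined by the matrix, which gives its multiset of letters. The word `i ↦ a (π i)` in turn
determines `π`, because `π` orders the positions by this letter and, among equal letters, from left
to right. -/
lemma pairMatrix_injective {n s : ℕ} {π ρ : Equiv.Perm (Fin (n + 1))} {a b : Fin (n + 1) → Fin s}
    (hπ : π * π = 1) (hρ : ρ * ρ = 1) (ha : IsCompatible π a) (hb : IsCompatible ρ b)
    (h : pairMatrix π a = pairMatrix ρ b) : π = ρ ∧ a = b := by
  have hmono : ∀ {π : Equiv.Perm (Fin (n + 1))} {a : Fin (n + 1) → Fin s}, IsCompatible π a →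
      Monotone fun i => toLex (a i, a (π i)) := by
    intro π a ha i j hij
    rcases hij.eq_or_lt with rfl | hij
    · exact le_rfl
    rw [Prod.Lex.toLex_le_toLex]
    rcases (ha.monotone hij.le).eq_or_lt with he | hlt
    · exact Or.inr ⟨he, ha.monotone (ha.lt_of_eq hij he).le⟩
    · exact Or.inl hlt
  have heq := monotone_eq_of_card_fiber_eq (hmono ha) (hmono hb) fun c => congrFun h (ofLex c)
  have hab : a = b := funext fun i => congrArg (fun z => (ofLex z).1) (congrFun heq i)
  have hab' : ∀ i, a (π i) = b (ρ i) := fun i => congrArg (fun z => (ofLex z).2) (congrFun heq i)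
  refine ⟨?_, hab⟩
  subst hab
  have hlt : ∀ {π : Equiv.Perm (Fin (n + 1))}, π * π = 1 → IsCompatible π a → ∀ i j,
      toLex (a (π i), i) < toLex (a (π j), j) → π i < π j := by
    intro π hπ ha i j hij
    have hinv : ∀ i, π (π i) = i := fun i => by
      have := congrArg (fun σ : Equiv.Perm (Fin (n + 1)) => σ i) hπ
      simpa using this
    rw [Prod.Lex.toLex_lt_toLex] at hij
    rcases hij with hij | ⟨he, hij⟩
    · exact lt_of_not_ge fun hle => absurd (ha.monotone hle) (not_le.2 hij)
    · by_contra hcon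
      have hne : π j ≠ π i := fun h => hij.ne (π.injective h).symm
      have := ha.lt_of_eq (lt_of_le_of_ne (not_lt.1 hcon) hne) he.symm
      rw [hinv, hinv] at this
      exact absurd hij this.asymm
  have hstrict : ∀ {π : Equiv.Perm (Fin (n + 1))}, π * π = 1 → IsCompatible π a →
      ∀ i j, π i < π j ↔ toLex (a (π i), i) < toLex (a (π j), j) := by
    intro π hπ ha i j
    refine ⟨fun h => ?_, hlt hπ ha i j⟩
    by_contra hcon
    rcases (not_lt.1 hcon).eq_or_lt with he | hlt'
    · rw [toLex_inj, Prod.mk.injEq] at he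
      rw [he.2] at h
      exact lt_irrefl _ h
    · exact absurd h (hlt hπ ha j i hlt').asymm
  have hmono' : StrictMono fun i => ρ (π⁻¹ i) := by
    intro i j hij
    have := (hstrict hπ ha (π⁻¹ i) (π⁻¹ j)).1 (by simpa using hij)
    rw [hab', hab'] at this
    exact (hstrict hρ hb _ _).2 this
  have hid : (fun i => ρ (π⁻¹ i)) = id :=
    (StrictMono.range_inj hmono' strictMono_id).1 (by
      rw [Set.range_id]
      exact (ρ.surjective.comp (π⁻¹ : Equiv.Perm _).surjective).range_eq)
  ext i
  have := congrFun hid (π i)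
  simpa using congrArg Fin.val this.symm

/-- The units of the matrix `A`: a cell `(x, y)` and a number less than `A (x, y)`. A separate type,
because it is ordered lexicographically, unlike the sigma type. -/
def Cell {s : ℕ} (A : Fin s × Fin s → ℕ) : Type := Σ p : Fin s × Fin s, Fin (A p)

instance {s : ℕ} (A : Fin s × Fin s → ℕ) : Fintype (Cell A) :=
  inferInstanceAs (Fintype (Σ p : Fin s × Fin s, Fin (A p)))

lemma card_cell {s : ℕ} (A : Fin s × Fin s → ℕ) : Fintype.card (Cell A) = ∑ p, A p := by
  change Fintype.card (Σ p : Fin s × Fin s, Fin (A p)) = _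
  simp

/-- List the units `(x, y, m)` of `A` in lexicographic order. The first coordinates form the word
`a`, and `π` is induced by `(x, y, m) ↦ (y, x, m)`. -/
lemma exists_pairMatrix_eq {n s : ℕ} {A : Fin s × Fin s → ℕ} (hA : A ∈ symmMatrices s (n + 1)) :
    ∃ (π : Equiv.Perm (Fin (n + 1))) (a : Fin (n + 1) → Fin s),
      π * π = 1 ∧ IsCompatible π a ∧ pairMatrix π a = A := by
  rw [mem_symmMatrices] at hA
  obtain ⟨hsum, hsymm⟩ := hA
  let Z := Cell A
  let key : Z → Fin s ×ₗ (Fin s ×ₗ ℕ) := fun z => toLex (z.1.1, toLex (z.1.2, (z.2 : ℕ)))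
  have hkey : Function.Injective key := by
    rintro ⟨⟨x, y⟩, m⟩ ⟨⟨x', y'⟩, m'⟩ h
    simp only [key, toLex_inj, Prod.mk.injEq] at h
    obtain ⟨rfl, rfl, h⟩ := h
    rw [Fin.ext h]
  let : LinearOrder Z := LinearOrder.lift' key hkey
  have hlt : ∀ z z' : Z, z < z' ↔ key z < key z' := fun _ _ => Iff.rfl
  have hcard : Fintype.card Z = n + 1 := (card_cell A).trans hsum
  let e : Fin (n + 1) ≃o Z := monoEquivOfFin Z hcard
  let swap : Z → Z := fun z => ⟨(z.1.2, z.1.1), Fin.cast (hsymm _ _) z.2⟩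
  have hswap : Function.Involutive swap := by
    rintro ⟨⟨x, y⟩, m⟩
    rfl
  let π : Equiv.Perm (Fin (n + 1)) :=
    (e.toEquiv.trans hswap.toPerm).trans e.symm.toEquiv
  have hπ : ∀ i, e (π i) = swap (e i) := fun i => e.apply_symm_apply _
  have hsnd : ∀ i, (e (π i)).1.1 = (e i).1.2 := fun i => by rw [hπ]
  refine ⟨π, fun i => (e i).1.1, ?_, ?_, ?_⟩
  · ext i
    have : e (π (π i)) = e i := by rw [hπ, hπ, hswap]
    simpa using congrArg Fin.val (e.injective this)
  · intro i
    have h := (hlt _ _).1 (e.strictMono i.castSucc_lt_succ)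
    simp only [key, Prod.Lex.toLex_lt_toLex] at h
    constructor
    · rcases h with h | h
      · exact h.le
      · exact h.1.le
    · intro hdes
      rcases h with h | ⟨h, h'⟩
      · exact h
      · exfalso
        -- Units with the same `x` keep their order when `x` and `y` are exchanged.
        refine hdes.asymm (e.lt_iff_lt.1 ?_)
        rw [hπ, hπ, hlt]
        simp only [key, swap, Prod.Lex.toLex_lt_toLex, Fin.val_cast]
        rcases h' with h' | ⟨h', h''⟩
        · exact Or.inl h'
        · exact Or.inr ⟨h', Or.inr ⟨h, h''⟩⟩
  · funext p
    simp only [pairMatrix, hsnd]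
    have : (Finset.univ.filter fun i => ((e i).1.1, (e i).1.2) = p) =
        (Finset.univ : Finset (Fin (A p))).map
          ⟨fun m => e.symm ⟨p, m⟩, e.symm.injective.comp sigma_mk_injective⟩ := by
      ext i
      simp only [Finset.mem_filter, Finset.mem_univ, true_and, Finset.mem_map,
        Function.Embedding.coeFn_mk, Prod.mk.eta]
      constructor
      · rintro rfl
        exact ⟨(e i).2, e.symm_apply_apply i⟩
      · rintro ⟨m, rfl⟩
        exact congrArg (fun z : Z => z.1) (e.apply_symm_apply (⟨p, m⟩ : Z))
    rw [this]
    simp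

theorem sum_choose_eq_card_symmMatrices (n s : ℕ) :
    ∑ π ∈ involutions (n + 1), (s + (n - des π)).choose (n + 1) =
      (symmMatrices s (n + 1)).card := by
  classical
  have hcount : ∀ π ∈ involutions (n + 1), (s + (n - des π)).choose (n + 1) =
      (Finset.univ.filter fun a : Fin (n + 1) → Fin s => IsCompatible π a).card := by
    intro π _
    rw [des_succ, ← card_compatible]
    refine congrArg Finset.card (Finset.ext fun a => ?_)
    rw [Finset.mem_filter, Finset.mem_filter]
    simp [IsCompatible]
  rw [Finset.sum_congr rfl hcount, ← Finset.card_sigma]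
  refine Finset.card_bij (fun x _ => pairMatrix x.1 x.2) ?_ ?_ ?_
  · rintro ⟨π, a⟩ h
    simp only [Finset.mem_sigma, involutions, Finset.mem_filter, Finset.mem_univ, true_and] at h
    exact pairMatrix_mem h.1 a
  · rintro ⟨π, a⟩ h ⟨ρ, b⟩ h' heq
    simp only [Finset.mem_sigma, involutions, Finset.mem_filter, Finset.mem_univ, true_and] at h h'
    obtain ⟨rfl, rfl⟩ := pairMatrix_injective h.1 h'.1 h.2 h'.2 heq
    rfl
  · intro A hA
    obtain ⟨π, a, h1, h2, h3⟩ := exists_pairMatrix_eq hA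
    exact ⟨⟨π, a⟩, by simp [involutions, h1, h2], h3⟩

/-! ### The descent polynomial and its γ-coefficients -/

lemma des_le {n : ℕ} (π : Equiv.Perm (Fin (n + 1))) : des π ≤ n := by
  rw [des_succ]
  exact (Finset.card_filter_le _ _).trans (by simp)

/-- The generating function of the symmetric matrices of sum `n + 1`, by size, is
`t I_{n+1}(t) / (1 - t)^(n + 2)`. -/
lemma mk_card_symmMatrices (n : ℕ) :
    (1 - PowerSeries.X : PowerSeries ℤ) ^ (n + 2) *
      PowerSeries.mk (fun s => ((symmMatrices s (n + 1)).card : ℤ)) =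
      PowerSeries.X * (involutionPoly (n + 1) : PowerSeries ℤ) := by
  have h1 : PowerSeries.mk (fun s => ((symmMatrices s (n + 1)).card : ℤ)) =
      ∑ π ∈ involutions (n + 1),
        PowerSeries.X ^ (des π + 1) * (PowerSeries.mk 1 : PowerSeries ℤ) ^ (n + 2) := by
    ext s
    rw [PowerSeries.coeff_mk, ← sum_choose_eq_card_symmMatrices, map_sum]
    push_cast
    refine Finset.sum_congr rfl fun π _ => ?_
    rw [PowerSeries.mk_one_pow_eq_mk_choose_add, PowerSeries.coeff_X_pow_mul', PowerSeries.coeff_mk]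
    have hd := des_le π
    split_ifs with h
    · rw [show n + 1 + (s - (des π + 1)) = s + (n - des π) by omega]
    · rw [Nat.choose_eq_zero_of_lt (by omega), Nat.cast_zero]
  have h2 : (PowerSeries.mk 1 : PowerSeries ℤ) ^ (n + 2) * (1 - PowerSeries.X) ^ (n + 2) = 1 := by
    rw [← mul_pow, PowerSeries.mk_one_mul_one_sub_eq_one, one_pow]
  have h3 : (involutionPoly (n + 1) : PowerSeries ℤ) =
      ∑ π ∈ involutions (n + 1), (PowerSeries.X : PowerSeries ℤ) ^ des π := by
    rw [involutionPoly, ← Polynomial.coeToPowerSeries.ringHom_apply, map_sum]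
    simp
  rw [h1, h3, ← Finset.sum_mul, Finset.mul_sum]
  simp only [pow_succ' _ (des _)]
  rw [← Finset.mul_sum]
  linear_combination
    (PowerSeries.X * ∑ π ∈ involutions (n + 1), (PowerSeries.X : PowerSeries ℤ) ^ des π) * h2

lemma involutionPoly_one : involutionPoly 1 = 1 := by
  have h : ∀ π ∈ involutions 1, des π = 0 := by decide
  have hc : (involutions 1).card = 1 := by decide
  rw [involutionPoly, Finset.sum_congr rfl fun π hπ => by rw [h π hπ]]
  simp [hc]

lemma involutionPoly_two : involutionPoly 2 = 1 + X := by
  have h : involutions 2 = {1, Equiv.swap 0 1} := by decide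
  have h1 : des (1 : Equiv.Perm (Fin 2)) = 0 := by decide
  have h2 : des (Equiv.swap 0 1 : Equiv.Perm (Fin 2)) = 1 := by decide
  rw [involutionPoly, h, Finset.sum_pair (by decide), h1, h2, pow_zero, pow_one]

theorem factorial_mul_involutionPoly (n : ℕ) :
    C ((n + 1).factorial : ℤ) * involutionPoly (n + 1) = gammaSum n (scaledGamma (n + 1)) := by
  refine factorial_mul_eq_gammaSum involutionPoly_one involutionPoly_two
    (recurrence_of_series (c := fun n s => ((symmMatrices s n).card : ℤ))
      mk_card_symmMatrices fun n s => ?_) n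
  have h := congrArg (Nat.cast : ℕ → ℤ) (card_symmMatrices_rec s n)
  push_cast at h
  exact h

lemma coeff_gammaSum (m : ℕ) (a : ℕ → ℤ) (i : ℕ) :
    (gammaSum m a).coeff i = ∑ k ∈ Finset.range (m / 2 + 1),
      if k ≤ i then a k * ((m - 2 * k).choose (i - k) : ℤ) else 0 := by
  rw [gammaSum, finsetSum_coeff]
  refine Finset.sum_congr rfl fun k _ => ?_
  rw [mul_assoc, coeff_C_mul, coeff_X_pow_mul', coeff_one_add_X_pow]
  split_ifs <;> simp

/-- The expansion is unitriangular, so a common divisor of the coefficients divides the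
γ-coefficients. For `N = 0` this is uniqueness of the expansion. -/
lemma dvd_of_dvd_coeff_gammaSum {m : ℕ} {a : ℕ → ℤ} {N : ℤ}
    (h : ∀ i, N ∣ (gammaSum m a).coeff i) {k : ℕ} (hk : k ≤ m / 2) : N ∣ a k := by
  induction k using Nat.strong_induction_on with
  | _ k ih =>
  have hc := h k
  rw [coeff_gammaSum, ← Finset.add_sum_erase _ _ (Finset.mem_range.2 (Nat.lt_succ_of_le hk))] at hc
  simp only [le_refl, if_true, Nat.sub_self, Nat.choose_zero_right, Nat.cast_one, mul_one] at hc
  refine (dvd_add_left (Finset.dvd_sum fun i hi => ?_)).1 hc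
  have hne := (Finset.mem_erase.1 hi).1
  split_ifs with hik
  · exact (ih i (lt_of_le_of_ne hik hne) (by omega)).mul_right _
  · exact dvd_zero _

lemma gammaSum_injective {m : ℕ} {a b : ℕ → ℤ} (h : gammaSum m a = gammaSum m b) {k : ℕ}
    (hk : k ≤ m / 2) : a k = b k := by
  have h0 : gammaSum m (fun k => a k + -1 * b k) = 0 := by
    rw [gammaSum_add, gammaSum_const_mul, h, C_neg, C_1]
    ring
  have := dvd_of_dvd_coeff_gammaSum (N := 0) (m := m) (a := fun k => a k + -1 * b k)
    (fun i => by rw [h0, coeff_zero]) hk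
  rw [zero_dvd_iff] at this
  linarith

lemma gammaSum_congr {m : ℕ} {a b : ℕ → ℤ} (h : ∀ k ≤ m / 2, a k = b k) :
    gammaSum m a = gammaSum m b :=
  Finset.sum_congr rfl fun k hk => by rw [h k (Nat.lt_succ_iff.1 (Finset.mem_range.1 hk))]

lemma coeff_gammaSum_symm {m i : ℕ} (a : ℕ → ℤ) (hi : i ≤ m) :
    (gammaSum m a).coeff i = (gammaSum m a).coeff (m - i) := by
  rw [coeff_gammaSum, coeff_gammaSum]
  refine Finset.sum_congr rfl fun k hk => ?_
  rw [Finset.mem_range] at hk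
  split_ifs with h1 h2 h2
  · rw [← Nat.choose_symm_of_eq_add (show m - 2 * k = i - k + (m - i - k) by omega)]
  · rw [Nat.choose_eq_zero_of_lt (by omega)]; simp
  · rw [Nat.choose_eq_zero_of_lt (by omega)]; simp
  · rfl

lemma coeff_gammaSum_zero (m : ℕ) (a : ℕ → ℤ) : (gammaSum m a).coeff 0 = a 0 := by
  rw [coeff_gammaSum, Finset.sum_range_succ']
  simp

lemma natTrailingDegree_gammaSum {m : ℕ} {a : ℕ → ℤ} (ha : a 0 ≠ 0) :
    (gammaSum m a).natTrailingDegree = 0 :=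
  natTrailingDegree_eq_zero.2 (Or.inr (by rwa [coeff_gammaSum_zero]))

lemma natDegree_gammaSum {m : ℕ} {a : ℕ → ℤ} (ha : a 0 ≠ 0) : (gammaSum m a).natDegree = m := by
  refine natDegree_eq_of_le_of_coeff_ne_zero (natDegree_le_iff_coeff_eq_zero.2 fun i hi => ?_) ?_
  · rw [coeff_gammaSum]
    refine Finset.sum_eq_zero fun k hk => ?_
    rw [Finset.mem_range] at hk
    rw [Nat.choose_eq_zero_of_lt (by omega)]
    simp
  · rw [coeff_gammaSum_symm a le_rfl, Nat.sub_self, coeff_gammaSum_zero]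
    exact ha

lemma isPalindromic_gammaSum {m : ℕ} {a : ℕ → ℤ} (ha : a 0 ≠ 0) :
    IsPalindromic (gammaSum m a) m := by
  rw [IsPalindromic, natTrailingDegree_gammaSum ha, natDegree_gammaSum ha]
  refine ⟨by omega, fun i hi => ?_⟩
  rw [zero_add] at hi ⊢
  exact coeff_gammaSum_symm a (by omega)

lemma isGammaExpansion_zero_iff {p : ℤ[X]} {m : ℕ} {a : ℕ → ℤ} :
    IsGammaExpansion p 0 m a ↔ p = gammaSum m a := by
  rw [IsGammaExpansion, gammaSum, Nat.range_succ_eq_Icc_zero]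

lemma exists_involutionPoly_eq_gammaSum (n : ℕ) :
    ∃ a : ℕ → ℤ, involutionPoly (n + 1) = gammaSum n a ∧ a 0 ≠ 0 ∧ ∀ k, 0 ≤ a k := by
  have hfac : (0 : ℤ) < (n + 1).factorial := by exact_mod_cast Nat.factorial_pos _
  have hmul := factorial_mul_involutionPoly n
  have hdvd : ∀ k ≤ n / 2, ((n + 1).factorial : ℤ) ∣ scaledGamma (n + 1) k := fun k hk =>
    dvd_of_dvd_coeff_gammaSum (fun i => by rw [← hmul, coeff_C_mul]; exact dvd_mul_right _ _) hk
  refine ⟨fun k => scaledGamma (n + 1) k / (n + 1).factorial, ?_, ?_, fun k => ?_⟩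
  · refine mul_left_cancel₀ (C_ne_zero.2 hfac.ne') ?_
    rw [hmul, ← gammaSum_const_mul]
    exact gammaSum_congr fun k hk => (Int.mul_ediv_cancel' (hdvd k hk)).symm
  · intro h
    have := Int.mul_ediv_cancel' (hdvd 0 (Nat.zero_le _))
    rw [show scaledGamma (n + 1) 0 / _ = 0 from h, mul_zero] at this
    exact (scaledGamma_zero_pos n).ne this
  · exact Int.ediv_nonneg ((scaledGamma_nonneg_and_ratio (n + 1)).1 k) hfac.le

theorem theorem1 (n : ℕ) (hn : 1 ≤ n) :
    IsGammaPositive (involutionPoly n) ∧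
      IsPalindromic (involutionPoly n) (n - 1) ∧
      ∃ a : ℕ → ℤ,
        IsGammaExpansion (involutionPoly n) 0 (n - 1) a ∧
        (∀ b : ℕ → ℤ, IsGammaExpansion (involutionPoly n) 0 (n - 1) b →
          ∀ k ≤ (n - 1) / 2, b k = a k) ∧
        ∀ k ≤ (n - 1) / 2, 0 ≤ a k := by
  obtain ⟨n, rfl⟩ : ∃ m, n = m + 1 := ⟨n - 1, by omega⟩
  obtain ⟨a, ha, ha0, hpos⟩ := exists_involutionPoly_eq_gammaSum n
  rw [Nat.add_sub_cancel, ha]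
  have hexp : IsGammaExpansion (gammaSum n a) 0 n a := isGammaExpansion_zero_iff.2 rfl
  refine ⟨⟨n, isPalindromic_gammaSum ha0, a, ?_, fun k _ => hpos k⟩, isPalindromic_gammaSum ha0,
    a, hexp, fun b hb k hk => ?_, fun k _ => hpos k⟩
  · rwa [natTrailingDegree_gammaSum ha0]
  · exact (gammaSum_injective (isGammaExpansion_zero_iff.1 hb) hk).symm
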